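/- For an indeterminate $q$, let $(a;q)_n=\prod_{i=0}^{n-1}(1-aq^i)$, let $[n]=1+q+\cdots+q^{n-1}$, and let $\Phi_n(q)$ be the $n$-th cyclotomic polynomial. For $A,B\in\mathbb{Z}(q)$ (rational functions in $q$ with integer coefficients) and $P\in\mathbb{Z}[q]$, write $A\equiv B\pmod{P}$ if $A-B=A_1/A_2$ for some $A_1,A_2\in\mathbb{Z}[q]$ with $A_2\ne 0$, $P\mid A_1$ and $\gcd(P,A_2)=1$. For $k\ge 0$ put \[ c_q(k)=\frac{(q;q^2)_k^2\,(q;q^2)_{2k}}{(q^6;q^6)_k^2\,(q^2;q^2)_{2k}}\,[8k+1]\,q^{2k^2}, \qquad a_q(k)=\sum_{j=0}^{k}c_q(j)\,c_q(k-j). \] Then for every positive integer $n$ coprime to $6$, \[ \sum_{k=0}^{n-1}a_q(k)\equiv q^{-(n-1)}[n]^2 \pmod{[n]\,\Phi_n(q)^2}. \] -/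

import Mathlib

open Polynomial

noncomputable section

/-- The `q`-shifted factorial `(a; q)_n = ∏_{i=0}^{n-1} (1 - a q^i)`. -/
def qPochhammer {R : Type*} [CommRing R] (a q : R) (n : ℕ) : R :=
  ∏ i ∈ Finset.range n, (1 - a * q ^ i)

/-- The `q`-integer `[n]_q = 1 + q + ⋯ + q^{n-1}`. -/
def qInteger {R : Type*} [CommRing R] (q : R) (n : ℕ) : R :=
  ∑ i ∈ Finset.range n, q ^ i

/-- In a field, `[n]_q = (1 - q^n) / (1 - q)` as soon as `q ≠ 1`. -/
theorem qInteger_eq_div {K : Type*} [Field K] {q : K} (hq : q ≠ 1) (n : ℕ) :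
    qInteger q n = (1 - q ^ n) / (1 - q) := by
  have h : (1 : K) - q ≠ 0 := sub_ne_zero.mpr (Ne.symm hq)
  rw [qInteger, eq_div_iff h]
  exact geom_sum_mul_neg q n

/-- Congruence of rational functions in `q` with integer coefficients modulo a polynomial
`P ∈ ℤ[q]`: the difference can be written as a fraction `A₁ / A₂` of polynomials in `ℤ[q]` with
`P ∣ A₁` and `gcd (P, A₂) = 1`, the gcd being taken in the factorial ring `ℤ[q]`. -/
def RatFuncCongr (P : ℤ[X]) (A B : RatFunc ℤ) : Prop :=
  ∃ A₁ A₂ : ℤ[X], A₂ ≠ 0 ∧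
    A - B = algebraMap ℤ[X] (RatFunc ℤ) A₁ / algebraMap ℤ[X] (RatFunc ℤ) A₂ ∧
    P ∣ A₁ ∧ IsRelPrime P A₂

/-- The `k`-th term
`(q;q²)_k² (q;q²)_{2k} / ((q⁶;q⁶)_k² (q²;q²)_{2k}) · [8k+1] q^{2k²}` of the series. -/
def cTerm {K : Type*} [Field K] (q : K) (k : ℕ) : K :=
  (qPochhammer q (q ^ 2) k ^ 2 * qPochhammer q (q ^ 2) (2 * k)) /
    (qPochhammer (q ^ 6) (q ^ 6) k ^ 2 * qPochhammer (q ^ 2) (q ^ 2) (2 * k)) *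
    qInteger q (8 * k + 1) * q ^ (2 * k ^ 2)

/-- The `k`-th coefficient `∑_{j=0}^k c_q(j) c_q(k-j)` of the square of the series. -/
def aTerm {K : Type*} [Field K] (q : K) (k : ℕ) : K :=
  ∑ j ∈ Finset.range (k + 1), cTerm q j * cTerm q (k - j)

end

/-! The modulus is the product of the `Φ_d` over divisors `d > 1` of `n`, with exponent 3 for `d =
n` and 1 otherwise. These primes are pairwise coprime, so it suffices to bound from below the order
at each `Φ_d` of the difference of the two sides. Write `d = 2h+1`.

For `d = n`: if `i, j < n` and `i + j ≥ n`, then `c(i) c(j)` has order at least 3, so the sum of the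
`a(k)` agrees with the square of `S = ∑_{k<n} c(k)` modulo `Φ_n³`. It remains to find `S` modulo
`Φ_n²`, up to sign. Deform `c(k)` by a parameter `a`, replacing squares by products such as `(1 - a
q^m)(1 - q^m/a)`; the values `a = 1` and `a = q^n` then agree modulo `Φ_n²`. At `a = q^n` the series
terminates. A telescoping certificate relates `a` to `a q⁶`, so the values at `n = 1` and `n = 5`
give `S ≡ ±[n] q^{-(n-1)/2}` (`exists_hasOrdGE_two_sum_cTerm_sub`). Squaring removes the sign and,
as both sides are divisible by `Φ_n`, gains one power.

For `d < n`: a Lucas-type congruence modulo `Φ_d` splits the sum into blocks, each congruent to a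
multiple of the square of `∑_{r<d} c(r)`, which is divisible by `Φ_d` (`hasOrdGE_one_sum_aTerm`). -/

noncomputable section

/-! ### Orders at a prime in a fraction field -/

section Order

set_option linter.unusedSectionVars false

variable {R K : Type*} [CommRing R] [IsDomain R] [Field K] [Algebra R K] [IsFractionRing R K]

/-- The order of `z` at the prime `p` is at least `m`. -/
def HasOrdGE (p : R) (m : ℤ) (z : K) : Prop :=
  ∃ x y : R, ¬ p ∣ y ∧ z = algebraMap R K p ^ m * (algebraMap R K x / algebraMap R K y)

/-- The order of `z` at the prime `p` is exactly `m`. -/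
def HasOrd (p : R) (m : ℤ) (z : K) : Prop :=
  ∃ x y : R, ¬ p ∣ x ∧ ¬ p ∣ y ∧
    z = algebraMap R K p ^ m * (algebraMap R K x / algebraMap R K y)

variable {p : R}

theorem algebraMap_ne_zero_of_not_dvd {y : R} (h : ¬ p ∣ y) : algebraMap R K y ≠ 0 := by
  intro h0
  have : y = 0 := (IsFractionRing.injective R K) (by simpa using h0)
  exact h (this ▸ dvd_zero p)

theorem Prime.algebraMap_ne_zero (hp : Prime p) : algebraMap R K p ≠ 0 := by
  intro h0
  exact hp.ne_zero ((IsFractionRing.injective R K) (by simpa using h0))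

theorem HasOrd.hasOrdGE {m : ℤ} {z : K} (h : HasOrd p m z) : HasOrdGE p m z := by
  obtain ⟨x, y, _, hy, rfl⟩ := h
  exact ⟨x, y, hy, rfl⟩

theorem hasOrdGE_algebraMap (hp : Prime p) (x : R) : HasOrdGE p 0 (algebraMap R K x) :=
  ⟨x, 1, hp.not_dvd_one, by simp⟩

theorem hasOrdGE_one (hp : Prime p) : HasOrdGE p 0 (1 : K) := by
  simpa using hasOrdGE_algebraMap (K := K) hp 1

theorem hasOrdGE_intCast (hp : Prime p) (m : ℤ) : HasOrdGE p 0 (m : K) := by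
  simpa using hasOrdGE_algebraMap (K := K) hp (m : R)

theorem hasOrdGE_zero (hp : Prime p) (m : ℤ) : HasOrdGE p m (0 : K) :=
  ⟨0, 1, hp.not_dvd_one, by simp⟩

theorem HasOrdGE.neg {m : ℤ} {z : K} (h : HasOrdGE p m z) : HasOrdGE p m (-z) := by
  obtain ⟨x, y, hy, rfl⟩ := h
  exact ⟨-x, y, hy, by simp [neg_div]⟩

theorem HasOrdGE.add (hp : Prime p) {m : ℤ} {z w : K} (hz : HasOrdGE p m z)
    (hw : HasOrdGE p m w) : HasOrdGE p m (z + w) := by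
  obtain ⟨x, y, hy, rfl⟩ := hz
  obtain ⟨u, v, hv, rfl⟩ := hw
  refine ⟨x * v + u * y, y * v, fun h => (hp.dvd_or_dvd h).elim hy hv, ?_⟩
  have h1 := algebraMap_ne_zero_of_not_dvd (K := K) hy
  have h2 := algebraMap_ne_zero_of_not_dvd (K := K) hv
  simp only [map_add, map_mul]
  field_simp

theorem HasOrdGE.sub (hp : Prime p) {m : ℤ} {z w : K} (hz : HasOrdGE p m z)
    (hw : HasOrdGE p m w) : HasOrdGE p m (z - w) := by
  rw [sub_eq_add_neg]
  exact hz.add hp hw.neg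

theorem HasOrdGE.mul (hp : Prime p) {m l : ℤ} {z w : K} (hz : HasOrdGE p m z)
    (hw : HasOrdGE p l w) : HasOrdGE p (m + l) (z * w) := by
  obtain ⟨x, y, hy, rfl⟩ := hz
  obtain ⟨u, v, hv, rfl⟩ := hw
  refine ⟨x * u, y * v, fun h => (hp.dvd_or_dvd h).elim hy hv, ?_⟩
  rw [zpow_add₀ hp.algebraMap_ne_zero, map_mul, map_mul, mul_div_mul_comm]
  ring

theorem HasOrdGE.mul_left (hp : Prime p) {m : ℤ} {z w : K} (hz : HasOrdGE p 0 z)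
    (hw : HasOrdGE p m w) : HasOrdGE p m (z * w) := by
  simpa using hz.mul hp hw

theorem HasOrdGE.mul_right (hp : Prime p) {m : ℤ} {z w : K} (hz : HasOrdGE p m z)
    (hw : HasOrdGE p 0 w) : HasOrdGE p m (z * w) := by
  simpa using hz.mul hp hw

theorem HasOrdGE.mono (hp : Prime p) {m l : ℤ} (hml : l ≤ m) {z : K} (hz : HasOrdGE p m z) :
    HasOrdGE p l z := by
  obtain ⟨x, y, hy, rfl⟩ := hz
  obtain ⟨t, rfl⟩ := Int.le.dest hml
  refine ⟨p ^ t * x, y, hy, ?_⟩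
  rw [zpow_add₀ hp.algebraMap_ne_zero, map_mul, map_pow, zpow_natCast]
  ring

theorem HasOrdGE.mul_sub_mul (hp : Prime p) {m : ℤ} {a a' b b' : K}
    (ha : HasOrdGE p m (a - a')) (hb : HasOrdGE p m (b - b')) (ha' : HasOrdGE p 0 a')
    (hb0 : HasOrdGE p 0 b) : HasOrdGE p m (a * b - a' * b') := by
  rw [show a * b - a' * b' = (a - a') * b + a' * (b - b') by ring]
  exact (ha.mul_right hp hb0).add hp (ha'.mul_left hp hb)

theorem HasOrdGE.sum (hp : Prime p) {ι : Type*} {s : Finset ι} {m : ℤ} {f : ι → K}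
    (h : ∀ i ∈ s, HasOrdGE p m (f i)) : HasOrdGE p m (∑ i ∈ s, f i) :=
  Finset.sum_induction f (HasOrdGE p m) (fun _ _ ha hb => ha.add hp hb) (hasOrdGE_zero hp m) h

theorem hasOrd_algebraMap (hp : Prime p) {x : R} (hx : ¬ p ∣ x) :
    HasOrd p 0 (algebraMap R K x) :=
  ⟨x, 1, hx, hp.not_dvd_one, by simp⟩

theorem hasOrd_one (hp : Prime p) : HasOrd p 0 (1 : K) := by
  simpa using hasOrd_algebraMap (K := K) hp hp.not_dvd_one

theorem HasOrd.mul (hp : Prime p) {m l : ℤ} {z w : K} (hz : HasOrd p m z)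
    (hw : HasOrd p l w) : HasOrd p (m + l) (z * w) := by
  obtain ⟨x, y, hx, hy, rfl⟩ := hz
  obtain ⟨u, v, hu, hv, rfl⟩ := hw
  refine ⟨x * u, y * v, fun h => (hp.dvd_or_dvd h).elim hx hu,
    fun h => (hp.dvd_or_dvd h).elim hy hv, ?_⟩
  rw [zpow_add₀ hp.algebraMap_ne_zero, map_mul, map_mul, mul_div_mul_comm]
  ring

theorem HasOrd.inv {m : ℤ} {z : K} (hz : HasOrd p m z) : HasOrd p (-m) z⁻¹ := by
  obtain ⟨x, y, hx, hy, rfl⟩ := hz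
  exact ⟨y, x, hy, hx, by rw [mul_inv, zpow_neg, inv_div]⟩

theorem HasOrd.div (hp : Prime p) {m l : ℤ} {z w : K} (hz : HasOrd p m z)
    (hw : HasOrd p l w) : HasOrd p (m - l) (z / w) := by
  rw [div_eq_mul_inv, sub_eq_add_neg]
  exact hz.mul hp hw.inv

theorem HasOrd.pow (hp : Prime p) {m : ℤ} {z : K} (hz : HasOrd p m z) (n : ℕ) :
    HasOrd p (n * m) (z ^ n) := by
  induction n with
  | zero => simpa using hasOrd_one hp
  | succ n ih =>
    rw [pow_succ, Nat.cast_succ, add_mul, one_mul]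
    exact ih.mul hp hz

theorem HasOrd.prod (hp : Prime p) {ι : Type*} (s : Finset ι) {m : ι → ℤ} {f : ι → K}
    (h : ∀ i ∈ s, HasOrd p (m i) (f i)) : HasOrd p (∑ i ∈ s, m i) (∏ i ∈ s, f i) := by
  classical
  induction s using Finset.induction_on with
  | empty => simpa using hasOrd_one hp
  | insert a s ha ih =>
    rw [Finset.sum_insert ha, Finset.prod_insert ha]
    exact (h a (by simp)).mul hp (ih fun i hi => h i (by simp [hi]))

theorem HasOrd.ne_zero (hp : Prime p) {m : ℤ} {z : K} (hz : HasOrd p m z) : z ≠ 0 := by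
  obtain ⟨x, y, hx, hy, rfl⟩ := hz
  exact mul_ne_zero (zpow_ne_zero _ hp.algebraMap_ne_zero) (div_ne_zero
    (algebraMap_ne_zero_of_not_dvd hx) (algebraMap_ne_zero_of_not_dvd hy))

theorem HasOrdGE.of_mul_right (hp : Prime p) {m : ℤ} {z w : K} (h : HasOrdGE p m (z * w))
    (hw : HasOrd p 0 w) : HasOrdGE p m z := by
  have h1 := h.mul_right hp (by simpa using hw.inv.hasOrdGE)
  rwa [mul_inv_cancel_right₀ (hw.ne_zero hp)] at h1

/-- A term of positive order cannot cancel the numerator of a unit modulo `p`. This carries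
invertibility from one sequence of denominators to a congruent one. -/
theorem HasOrd.of_sub (hp : Prime p) {z w : K} (hz : HasOrd p 0 z)
    (h : HasOrdGE p 1 (z - w)) : HasOrd p 0 w := by
  obtain ⟨x, y, hx, hy, hz⟩ := hz
  obtain ⟨u, v, hv, h⟩ := h
  refine ⟨x * v - p * u * y, y * v, fun h => ?_, fun h => (hp.dvd_or_dvd h).elim hy hv, ?_⟩
  · have h1 : p ∣ x * v := (dvd_sub_left (by rw [mul_assoc]; exact dvd_mul_right _ _)).1 h
    exact (hp.dvd_or_dvd h1).elim hx hv
  · have h1 := algebraMap_ne_zero_of_not_dvd (K := K) hy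
    have h2 := algebraMap_ne_zero_of_not_dvd (K := K) hv
    have : w = z - (z - w) := by ring
    rw [this, h, hz]
    simp only [map_sub, map_mul, zpow_zero, zpow_one]
    field_simp

/-- Two hypergeometric sequences with congruent term ratios are congruent. -/
theorem hasOrdGE_sub_of_recurrence (hp : Prime p) {m : ℤ} (hm : 1 ≤ m) {N : ℕ}
    {e e' num num' den den' : ℕ → K}
    (he : ∀ k < N, e (k + 1) * den k = e k * num k)
    (he' : ∀ k < N, e' (k + 1) * den' k = e' k * num' k)
    (h0 : HasOrdGE p m (e 0 - e' 0))
    (hint : ∀ k ≤ N, HasOrdGE p 0 (e k))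
    (hnum : ∀ k < N, HasOrdGE p m (num k - num' k))
    (hden : ∀ k < N, HasOrdGE p m (den k - den' k))
    (hnum_int : ∀ k < N, HasOrdGE p 0 (num k))
    (hunit : ∀ k < N, HasOrd p 0 (den k)) :
    ∀ k ≤ N, HasOrdGE p m (e k - e' k) := by
  intro k
  induction k with
  | zero => exact fun _ => h0
  | succ k ih =>
    intro hk
    have hk' : k < N := hk
    have ihk := ih hk'.le
    have hu : HasOrd p 0 (den' k) := (hunit k hk').of_sub hp ((hden k hk').mono hp hm)
    have hn' : HasOrdGE p 0 (num' k) := by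
      have := (hnum_int k hk').sub hp ((hnum k hk').mono hp (by omega))
      simpa using this
    refine HasOrdGE.of_mul_right hp ?_ hu
    -- Both recurrences are used without division; each summand on the right contains a factor of
    -- order at least `m`.
    have key : (e (k + 1) - e' (k + 1)) * den' k =
        e k * (num k - num' k) - e (k + 1) * (den k - den' k) + (e k - e' k) * num' k := by
      linear_combination he k hk' - he' k hk'
    rw [key]
    exact (((hint k hk'.le).mul_left hp (hnum k hk')).sub hp
      ((hint _ hk).mul_left hp (hden k hk'))).add hp (ihk.mul_right hp hn')

/-- The passage back from orders to divisibility. The denominator `y` may itself be divisible by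
`p`, which only makes the conclusion weaker than the truth. -/
theorem HasOrdGE.pow_dvd_of_div (hp : Prime p) {m : ℕ} {x y : R} (hy : algebraMap R K y ≠ 0)
    (h : HasOrdGE p m (algebraMap R K x / algebraMap R K y)) : p ^ m ∣ x := by
  obtain ⟨u, v, hv, h⟩ := h
  have h2 := algebraMap_ne_zero_of_not_dvd (K := K) hv
  have h3 : x * v = p ^ m * (u * y) := by
    apply IsFractionRing.injective R K
    rw [zpow_natCast] at h
    field_simp at h
    simp only [map_mul, map_pow]
    linear_combination h
  have h4 : p ^ m ∣ x * v := ⟨_, h3⟩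
  exact hp.pow_dvd_of_dvd_mul_right m hv h4

end Order

/-! ### The deformed series and its telescoping certificate -/

section Deformation

set_option linter.unusedVariables false

variable {K : Type*} [Field K]

/-- The deformation of `cTerm q k / [8k+1]` by a parameter `a`, which is recovered at `a = 1`. -/
def baseTerm (q a : K) (k : ℕ) : K :=
  (qPochhammer (a * q) (q ^ 2) k * qPochhammer (q / a) (q ^ 2) k *
      qPochhammer q (q ^ 2) (2 * k)) /
    (qPochhammer (a * q ^ 6) (q ^ 6) k * qPochhammer (q ^ 6 / a) (q ^ 6) k *
      qPochhammer (q ^ 2) (q ^ 2) (2 * k)) * q ^ (2 * k ^ 2)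

/-- The numerator of `baseTerm q a (k + 1) / baseTerm q a k`. -/
def baseNum (q a : K) (k : ℕ) : K :=
  (1 - a * q ^ (2 * k + 1)) * (1 - q ^ (2 * k + 1) / a) * (1 - q ^ (4 * k + 1)) *
    (1 - q ^ (4 * k + 3)) * q ^ (4 * k + 2)

/-- The denominator of `baseTerm q a (k + 1) / baseTerm q a k`. -/
def baseDen (q a : K) (k : ℕ) : K :=
  (1 - a * q ^ (6 * k + 6)) * (1 - q ^ (6 * k + 6) / a) * (1 - q ^ (4 * k + 2)) *
    (1 - q ^ (4 * k + 4))

theorem cTerm_eq (q : K) (k : ℕ) : cTerm q k = baseTerm q 1 k * qInteger q (8 * k + 1) := by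
  simp only [cTerm, baseTerm, one_mul, div_one]
  ring

@[simp] theorem qPochhammer_zero (a q : K) : qPochhammer a q 0 = 1 := by
  simp [qPochhammer]

theorem qPochhammer_succ (a q : K) (k : ℕ) :
    qPochhammer a q (k + 1) = qPochhammer a q k * (1 - a * q ^ k) := by
  simp [qPochhammer, Finset.prod_range_succ]

theorem qPochhammer_shift (a q : K) (k : ℕ) :
    qPochhammer (a * q) q k * (1 - a) = qPochhammer a q k * (1 - a * q ^ k) := by
  rw [← qPochhammer_succ, qPochhammer, qPochhammer, Finset.prod_range_succ']
  simp only [pow_zero, mul_one, pow_succ']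
  congr 1
  exact Finset.prod_congr rfl fun i _ => by ring

theorem baseTerm_zero (q a : K) : baseTerm q a 0 = 1 := by simp [baseTerm]

theorem baseTerm_succ (q a : K) (k : ℕ) (h : baseDen q a k ≠ 0) :
    baseTerm q a (k + 1) * baseDen q a k = baseTerm q a k * baseNum q a k := by
  simp only [baseTerm, show 2 * (k + 1) = 2 * k + 1 + 1 by ring, qPochhammer_succ]
  have e1 : baseDen q a k = (1 - a * q ^ 6 * (q ^ 6) ^ k) * (1 - q ^ 6 / a * (q ^ 6) ^ k) *
      ((1 - q ^ 2 * (q ^ 2) ^ (2 * k)) * (1 - q ^ 2 * (q ^ 2) ^ (2 * k + 1))) := by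
    rw [baseDen]; ring
  have e2 : baseNum q a k = (1 - a * q * (q ^ 2) ^ k) * (1 - q / a * (q ^ 2) ^ k) *
      ((1 - q * (q ^ 2) ^ (2 * k)) * (1 - q * (q ^ 2) ^ (2 * k + 1))) * q ^ (4 * k + 2) := by
    rw [baseNum]; ring
  have e3 : q ^ (2 * (k + 1) ^ 2) = q ^ (2 * k ^ 2) * q ^ (4 * k + 2) := by ring
  have cancel : ∀ A a B b C c d A' x B' y C' z w Q s : K, x * y * (z * w) ≠ 0 →
      A * a * (B * b) * (C * c * d) / (A' * x * (B' * y) * (C' * z * w)) * (Q * s) *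
        (x * y * (z * w)) = A * B * C / (A' * B' * C') * Q * (a * b * (c * d) * s) := by
    intro A a B b C c d A' x B' y C' z w Q s hne
    rw [show A' * x * (B' * y) * (C' * z * w) = A' * B' * C' * (x * y * (z * w)) by ring,
      ← div_div, mul_right_comm, div_mul_cancel₀ _ hne]
    ring
  rw [e1] at h ⊢
  rw [e2, e3]
  exact cancel _ _ _ _ _ _ _ _ _ _ _ _ _ _ _ _ h

/-- The telescoping certificate of the step `a ↦ a q⁶`. -/
def certificate (q a : K) (k : ℕ) : K :=
  (qPochhammer (a * q) (q ^ 2) k * qPochhammer (q / (a * q ^ 6)) (q ^ 2) k *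
      qPochhammer q (q ^ 2) (2 * k)) /
    (qPochhammer (a * q ^ 6) (q ^ 6) k * qPochhammer (q ^ 6 / a) (q ^ 6) k *
      qPochhammer (q ^ 2) (q ^ 2) (2 * k)) * q ^ (2 * k ^ 2) *
  ((1 - q ^ (6 * k) / a) * (1 - q ^ (4 * k)) * (1 - q ^ (4 * k) / q ^ 2) * (1 - a * q ^ 6) *
    (a * q ^ 3) * (1 - a ^ 2 * q ^ 6) / ((1 - a * q) * (1 - a * q ^ 3) * (1 - a * q ^ 5)))

/-- The telescoping relation after division by the common `q`-factorials and `q^(2k²)`, with `x`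
standing for `q^(2k)`. What remains is an identity of rational functions in `q`, `a`, `x`. -/
theorem certificate_identity (q a x : K) (hq : q ≠ 0) (ha : a ≠ 0)
    (a0 : 1 - a ≠ 0) (a1 : 1 - a * q ≠ 0) (a3 : 1 - a * q ^ 3 ≠ 0) (a5 : 1 - a * q ^ 5 ≠ 0)
    (a6 : 1 - a * q ^ 6 ≠ 0) (w : 1 - a * q ^ 6 * x ^ 3 ≠ 0) (v : a - q ^ 6 * x ^ 3 ≠ 0)
    (z : 1 - q ^ 2 * x ^ 2 ≠ 0) (z' : 1 - q ^ 4 * x ^ 2 ≠ 0) :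
    ((1 - a * q * x) * (1 - x / (a * q ^ 5)) * (1 - q * x ^ 2) * (1 - q ^ 3 * x ^ 2)) /
        ((1 - a * q ^ 6 * x ^ 3) * (1 - q ^ 6 * x ^ 3 / a) * (1 - q ^ 2 * x ^ 2) *
          (1 - q ^ 4 * x ^ 2)) * (q ^ 2 * x ^ 2) *
        ((1 - q ^ 6 * x ^ 3 / a) * (1 - q ^ 4 * x ^ 2) * (1 - q ^ 4 * x ^ 2 / q ^ 2) *
          (1 - a * q ^ 6) * (a * q ^ 3) * (1 - a ^ 2 * q ^ 6) /
            ((1 - a * q) * (1 - a * q ^ 3) * (1 - a * q ^ 5))) -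
      (1 - x ^ 3 / a) * (1 - x ^ 2) * (1 - x ^ 2 / q ^ 2) *
          (1 - a * q ^ 6) * (a * q ^ 3) * (1 - a ^ 2 * q ^ 6) /
            ((1 - a * q) * (1 - a * q ^ 3) * (1 - a * q ^ 5)) =
    q ^ 3 * (1 - a) * (((1 - a * q * x) * (1 - a * q ^ 3 * x) * (1 - a * q ^ 5 * x)) /
        ((1 - a * q) * (1 - a * q ^ 3) * (1 - a * q ^ 5)) * ((1 - a * q ^ 6) /
          (1 - a * q ^ 6 * x ^ 3)) * ((1 - x ^ 3 / a) / (1 - 1 / a)) * (1 - q * x ^ 4)) -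
    (1 - a * q ^ 6) * (((x - a * q) * (x - a * q ^ 3) * (x - a * q ^ 5)) /
        ((1 - a * q) * (1 - a * q ^ 3) * (1 - a * q ^ 5)) * (1 - q * x ^ 4)) := by
  rw [show 1 - q ^ 6 * x ^ 3 / a = (a - q ^ 6 * x ^ 3) / a by field_simp,
    show (1 - x ^ 3 / a) / (1 - 1 / a) = (x ^ 3 - a) / (1 - a) by
      rw [show 1 - 1 / a = - (1 - a) / a by field_simp; ring]
      field_simp; ring]
  field_simp
  ring

/-- Replacing `a` by `a q⁶` is three steps for the symbols in base `q²`, but a single step for those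
in base `q⁶`. -/
theorem qPochhammer_shift_three {a q : K} (h0 : 1 - a ≠ 0) (h1 : 1 - a * q ≠ 0)
    (h2 : 1 - a * q ^ 2 ≠ 0) (k : ℕ) :
    qPochhammer (a * q ^ 3) q k = qPochhammer a q k *
      (((1 - a * q ^ k) * (1 - a * q * q ^ k) * (1 - a * q ^ 2 * q ^ k)) /
        ((1 - a) * (1 - a * q) * (1 - a * q ^ 2))) := by
  have s1 := qPochhammer_shift a q k
  have s2 := qPochhammer_shift (a * q) q k
  have s3 := qPochhammer_shift (a * q * q) q k
  rw [show a * q * q * q = a * q ^ 3 by ring, show a * q * q = a * q ^ 2 by ring] at s3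
  rw [show a * q * q = a * q ^ 2 by ring] at s2
  rw [← mul_div_assoc, eq_div_iff (by simp [*])]
  linear_combination (1 - a * q) * (1 - a) * s3 + (1 - a) * (1 - a * q ^ 2 * q ^ k) * s2 +
    (1 - a * q * q ^ k) * (1 - a * q ^ 2 * q ^ k) * s1

theorem certificate_succ_sub (q a : K) (hq : q ≠ 0) (ha : a ≠ 0)
    (hq1 : ∀ i : ℕ, 0 < i → 1 - q ^ i ≠ 0) (haq : ∀ i : ℕ, 1 - a * q ^ i ≠ 0)
    (hqa : ∀ i : ℕ, a - q ^ (6 * i) ≠ 0) (k : ℕ) :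
    certificate q a (k + 1) - certificate q a k =
      q ^ 3 * (1 - a) * (baseTerm q (a * q ^ 6) k * (1 - q ^ (8 * k + 1))) -
        (1 - a * q ^ 6) * (baseTerm q a k * (1 - q ^ (8 * k + 1))) := by
  have a0 : 1 - a ≠ 0 := by simpa using haq 0
  have a1 : 1 - a * q ≠ 0 := by simpa using haq 1
  have a3 := haq 3
  have a5 := haq 5
  have a6 := haq 6
  have inv_ne : ∀ i : ℕ, 1 - 1 / (a * q ^ i) ≠ 0 := fun i => by
    rw [show 1 - 1 / (a * q ^ i) = - (1 - a * q ^ i) / (a * q ^ i) by field_simp; ring]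
    exact div_ne_zero (neg_ne_zero.2 (haq i)) (mul_ne_zero ha (pow_ne_zero _ hq))
  have hw : 1 - a * q ^ 6 * (q ^ (2 * k)) ^ 3 ≠ 0 := by
    convert haq (6 * k + 6) using 1; ring
  have hv : a - q ^ 6 * (q ^ (2 * k)) ^ 3 ≠ 0 := by
    convert hqa (k + 1) using 1; ring
  have hv' : a - (q ^ (2 * k)) ^ 3 ≠ 0 := by
    convert hqa k using 1; ring
  have hz : 1 - q ^ 2 * (q ^ (2 * k)) ^ 2 ≠ 0 := by
    convert hq1 (4 * k + 2) (by omega) using 1; ring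
  have hz' : 1 - q ^ 4 * (q ^ (2 * k)) ^ 2 ≠ 0 := by
    convert hq1 (4 * k + 4) (by omega) using 1; ring
  have key := certificate_identity q a (q ^ (2 * k)) hq ha a0 a1 a3 a5 a6 hw hv hz hz'
  -- The four parameter-dependent symbols are rewritten through those in `certificate q a k`, so
  -- that a single common factor can be pulled out.
  have eP : qPochhammer (a * q ^ 6 * q) (q ^ 2) k = qPochhammer (a * q) (q ^ 2) k *
      (((1 - a * q * q ^ (2 * k)) * (1 - a * q ^ 3 * q ^ (2 * k)) *
        (1 - a * q ^ 5 * q ^ (2 * k))) / ((1 - a * q) * (1 - a * q ^ 3) * (1 - a * q ^ 5))) := by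
    have := qPochhammer_shift_three (a := a * q) (q := q ^ 2) a1 (by convert a3 using 1; ring)
      (by convert a5 using 1; ring) k
    convert this using 2 <;> ring
  have eR : qPochhammer (q / a) (q ^ 2) k = qPochhammer (q / (a * q ^ 6)) (q ^ 2) k *
      (((q ^ (2 * k) - a * q) * (q ^ (2 * k) - a * q ^ 3) * (q ^ (2 * k) - a * q ^ 5)) /
        ((1 - a * q) * (1 - a * q ^ 3) * (1 - a * q ^ 5))) := by
    have e1 : q / (a * q ^ 6) = 1 / (a * q ^ 5) := by field_simp
    have e2 : 1 / (a * q ^ 5) * q ^ 2 = 1 / (a * q ^ 3) := by field_simp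
    have e3 : 1 / (a * q ^ 5) * (q ^ 2) ^ 2 = 1 / (a * q ^ 1) := by field_simp
    have := qPochhammer_shift_three (a := 1 / (a * q ^ 5)) (q := q ^ 2) (inv_ne 5)
      (by rw [e2]; exact inv_ne 3) (by rw [e3]; exact inv_ne 1) k
    rw [show 1 / (a * q ^ 5) * (q ^ 2) ^ 3 = q / a by field_simp, e2, e3, ← pow_mul] at this
    rw [this, e1]
    have f : ∀ (i : ℕ) (x : K), 1 - 1 / (a * q ^ i) * x = (x - a * q ^ i) / (- (a * q ^ i)) := by
      intro i x; field_simp; ring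
    have g : ∀ i : ℕ, 1 - 1 / (a * q ^ i) = (1 - a * q ^ i) / (- (a * q ^ i)) := by
      intro i; simpa using f i 1
    have a1' : a * q - 1 ≠ 0 := sub_ne_zero.2 (sub_ne_zero.1 a1).symm
    simp only [f, g, pow_one]
    field_simp
    ring
  have eW : qPochhammer (a * q ^ 6 * q ^ 6) (q ^ 6) k = qPochhammer (a * q ^ 6) (q ^ 6) k *
      ((1 - a * q ^ 6 * (q ^ (2 * k)) ^ 3) / (1 - a * q ^ 6)) := by
    have := qPochhammer_shift (a * q ^ 6) (q ^ 6) k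
    rw [← mul_div_assoc, eq_div_iff a6, this]
    ring
  have eV : qPochhammer (q ^ 6 / (a * q ^ 6)) (q ^ 6) k = qPochhammer (q ^ 6 / a) (q ^ 6) k *
      ((1 - 1 / a) / (1 - (q ^ (2 * k)) ^ 3 / a)) := by
    have := qPochhammer_shift (1 / a) (q ^ 6) k
    rw [show 1 / a * q ^ 6 = q ^ 6 / a by ring] at this
    have h : 1 - (q ^ (2 * k)) ^ 3 / a ≠ 0 := by
      rw [show 1 - (q ^ (2 * k)) ^ 3 / a = (a - (q ^ (2 * k)) ^ 3) / a by field_simp]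
      exact div_ne_zero hv' ha
    rw [show q ^ 6 / (a * q ^ 6) = 1 / a by field_simp, ← mul_div_assoc, eq_div_iff h, this]
    ring
  simp only [certificate, baseTerm, show 2 * (k + 1) = 2 * k + 1 + 1 by ring, qPochhammer_succ,
    eP, eR, eW, eV]
  set P := qPochhammer (a * q) (q ^ 2) k
  set R := qPochhammer (q / (a * q ^ 6)) (q ^ 2) k
  set U := qPochhammer q (q ^ 2) (2 * k)
  set W := qPochhammer (a * q ^ 6) (q ^ 6) k
  set V := qPochhammer (q ^ 6 / a) (q ^ 6) k
  set Z := qPochhammer (q ^ 2) (q ^ 2) (2 * k)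
  have p1 : (q ^ 2) ^ k = q ^ (2 * k) := by ring
  have p2 : (q ^ 6) ^ k = (q ^ (2 * k)) ^ 3 := by ring
  have p3 : (q ^ 2) ^ (2 * k) = (q ^ (2 * k)) ^ 2 := by ring
  have p4 : (q ^ 2) ^ (2 * k + 1) = q ^ 2 * (q ^ (2 * k)) ^ 2 := by ring
  have p5 : q ^ (8 * k + 1) = q * (q ^ (2 * k)) ^ 4 := by ring
  have p6 : q ^ (6 * k) = (q ^ (2 * k)) ^ 3 := by ring
  have p7 : q ^ (4 * k) = (q ^ (2 * k)) ^ 2 := by ring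
  have p8 : q ^ (6 * (k + 1)) = q ^ 6 * (q ^ (2 * k)) ^ 3 := by ring
  have p9 : q ^ (4 * (k + 1)) = q ^ 4 * (q ^ (2 * k)) ^ 2 := by ring
  have p10 : q ^ (2 * (k + 1) ^ 2) = q ^ (2 * k ^ 2) * (q ^ 2 * (q ^ (2 * k)) ^ 2) := by ring
  have p11 : q / (a * q ^ 6) * q ^ (2 * k) = q ^ (2 * k) / (a * q ^ 5) := by field_simp
  simp only [p1, p2, p3, p4, p5, p6, p7, p8, p9, p10, p11]
  have key' := congrArg (fun t => P * R * U / (W * V * Z) * q ^ (2 * k ^ 2) * t) key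
  generalize q ^ (2 * k) = x at *
  generalize q ^ (2 * k ^ 2) = y at *
  convert key' using 1
  · rw [mul_sub]
    rw [show q ^ 6 / a * x ^ 3 = q ^ 6 * x ^ 3 / a by ring,
      show q ^ 2 * (q ^ 2 * x ^ 2) = q ^ 4 * x ^ 2 by ring,
      show q * (q ^ 2 * x ^ 2) = q ^ 3 * x ^ 2 by ring]
    simp only [div_eq_mul_inv, mul_inv]
    ring
  · simp only [div_eq_mul_inv, mul_inv, inv_inv]
    ring

/-- The differences telescope, and the certificate vanishes at `0` through its factor `1 - q^(4k)`.
-/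
theorem certificate_eq_sum (q a : K) (hq : q ≠ 0) (ha : a ≠ 0)
    (hq1 : ∀ i : ℕ, 0 < i → 1 - q ^ i ≠ 0) (haq : ∀ i : ℕ, 1 - a * q ^ i ≠ 0)
    (hqa : ∀ i : ℕ, a - q ^ (6 * i) ≠ 0) (N : ℕ) :
    q ^ 3 * (1 - a) * ∑ k ∈ Finset.range N, baseTerm q (a * q ^ 6) k * (1 - q ^ (8 * k + 1)) -
        (1 - a * q ^ 6) * ∑ k ∈ Finset.range N, baseTerm q a k * (1 - q ^ (8 * k + 1)) =
      certificate q a N := by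
  induction N with
  | zero => simp [certificate]
  | succ N ih =>
    rw [Finset.sum_range_succ, Finset.sum_range_succ]
    linear_combination ih - certificate_succ_sub q a hq ha hq1 haq hqa N

end Deformation

/-! ### Closed form of the terminating series at `a = q^n` -/

section Evaluation

variable {K : Type*} [Field K]

theorem qPochhammer_eq_zero {a q : K} {i N : ℕ} (hi : i < N) (h : a * q ^ i = 1) :
    qPochhammer a q N = 0 :=
  Finset.prod_eq_zero (Finset.mem_range.2 hi) (by rw [h, sub_self])

theorem baseTerm_eq_zero {q : K} (hq : q ≠ 0) {h k : ℕ} (hk : h < k) :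
    baseTerm q (q ^ (2 * h + 1)) k = 0 := by
  have : qPochhammer (q / q ^ (2 * h + 1)) (q ^ 2) k = 0 :=
    qPochhammer_eq_zero hk (by rw [pow_succ, ← pow_mul]; field_simp)
  simp [baseTerm, this]

/-- Here `q / (a q⁶) = q^(-2(h+3))`, so the factor of index `h + 3` is zero; the boundary term
disappears once the range passes it. -/
theorem certificate_eq_zero {q : K} (hq : q ≠ 0) {h k : ℕ} (hk : h + 3 < k) :
    certificate q (q ^ (2 * h + 1)) k = 0 := by
  have : qPochhammer (q / (q ^ (2 * h + 1) * q ^ 6)) (q ^ 2) k = 0 :=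
    qPochhammer_eq_zero hk (by
      rw [← pow_add, show 2 * h + 1 + 6 = 2 * (h + 3) + 1 by ring, pow_succ, ← pow_mul]
      field_simp)
  simp [certificate, this]

/-- The truncated series at the specialization `a = q^n`. -/
def specialSum (q : K) (n N : ℕ) : K :=
  ∑ k ∈ Finset.range N, baseTerm q (q ^ n) k * (1 - q ^ (8 * k + 1))

theorem pow_sub_pow_ne_zero {q : K} (hq : q ≠ 0) (hq1 : ∀ i : ℕ, 0 < i → 1 - q ^ i ≠ 0)
    {i j : ℕ} (hij : i ≠ j) : q ^ i - q ^ j ≠ 0 := by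
  rcases lt_or_gt_of_ne hij with h | h
  · obtain ⟨t, rfl⟩ := Nat.exists_eq_add_of_lt h
    rw [show q ^ i - q ^ (i + t + 1) = q ^ i * (1 - q ^ (t + 1)) by ring]
    exact mul_ne_zero (pow_ne_zero _ hq) (hq1 _ (by omega))
  · obtain ⟨t, rfl⟩ := Nat.exists_eq_add_of_lt h
    rw [show q ^ (j + t + 1) - q ^ j = - (q ^ j * (1 - q ^ (t + 1))) by ring]
    exact neg_ne_zero.2 (mul_ne_zero (pow_ne_zero _ hq) (hq1 _ (by omega)))

/-- The exponent of `a` is odd, so `a` is never a power of `q⁶` and the certificate has no pole. -/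
theorem specialSum_add_six {q : K} (hq : q ≠ 0) (hq1 : ∀ i : ℕ, 0 < i → 1 - q ^ i ≠ 0)
    {h N : ℕ} (hN : h + 3 < N) :
    q ^ 3 * (1 - q ^ (2 * h + 1)) * specialSum q (2 * h + 1 + 6) N =
      (1 - q ^ (2 * h + 1 + 6)) * specialSum q (2 * h + 1) N := by
  have := certificate_eq_sum q (q ^ (2 * h + 1)) hq (pow_ne_zero _ hq) hq1
    (fun i => by rw [← pow_add]; exact hq1 _ (by omega))
    (fun i => pow_sub_pow_ne_zero hq hq1 (by omega)) N
  rw [certificate_eq_zero hq hN, sub_eq_zero, ← pow_add] at this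
  exact this

theorem specialSum_one {q : K} (hq : q ≠ 0) {N : ℕ} (hN : 0 < N) :
    specialSum q 1 N = 1 - q := by
  rw [specialSum, Finset.sum_eq_single_of_mem 0 (Finset.mem_range.2 hN)]
  · simp [baseTerm_zero]
  · intro k _ hk
    rw [show (1 : ℕ) = 2 * 0 + 1 from rfl, baseTerm_eq_zero hq (Nat.pos_of_ne_zero hk), zero_mul]

/-- The step of length 6 starting from 1 misses the class of 5 modulo 6, which needs its own
starting value. Only the terms `k = 0, 1, 2` survive. -/
theorem specialSum_five {q : K} (hq : q ≠ 0) (hq1 : ∀ i : ℕ, 0 < i → 1 - q ^ i ≠ 0) {N : ℕ}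
    (hN : 3 ≤ N) : specialSum q 5 N * q ^ 2 = -(1 - q ^ 5) := by
  have h3 : specialSum q 5 N = specialSum q 5 3 := by
    symm
    apply Finset.sum_subset (Finset.range_mono hN)
    intro k _ hk
    rw [show (5 : ℕ) = 2 * 2 + 1 from rfl, baseTerm_eq_zero hq (by have := Finset.mem_range.not.1 hk; omega), zero_mul]
  have r0 := baseTerm_succ q (q ^ 5) 0
  have r1 := baseTerm_succ q (q ^ 5) 1
  have d0 : baseDen q (q ^ 5) 0 = (1 - q ^ 11) * (1 - q) * (1 - q ^ 2) * (1 - q ^ 4) := by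
    simp only [baseDen]; field_simp; ring
  have d1 : baseDen q (q ^ 5) 1 = (1 - q ^ 17) * (1 - q ^ 7) * (1 - q ^ 6) * (1 - q ^ 8) := by
    simp only [baseDen]; field_simp; ring
  have n0 : baseNum q (q ^ 5) 0 =
      (1 - q ^ 6) * ((q ^ 4 - 1) / q ^ 4) * (1 - q) * (1 - q ^ 3) * q ^ 2 := by
    simp only [baseNum]; field_simp; ring
  have n1 : baseNum q (q ^ 5) 1 =
      (1 - q ^ 8) * ((q ^ 2 - 1) / q ^ 2) * (1 - q ^ 5) * (1 - q ^ 7) * q ^ 6 := by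
    simp only [baseNum]; field_simp; ring
  have f1 : 1 - q ≠ 0 := by simpa using hq1 1 one_pos
  have f2 := hq1 2 (by norm_num)
  have f4 := hq1 4 (by norm_num)
  have f6 := hq1 6 (by norm_num)
  have f7 := hq1 7 (by norm_num)
  have f8 := hq1 8 (by norm_num)
  have f11 := hq1 11 (by norm_num)
  have f17 := hq1 17 (by norm_num)
  rw [d0, n0, baseTerm_zero] at r0
  rw [d1, n1] at r1
  have r0' := r0 (by simp [*])
  have r1' := r1 (by simp [*])
  rw [← eq_div_iff (by simp [*])] at r0' r1'
  simp only [zero_add, Nat.reduceAdd] at r0' r1'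
  rw [h3, specialSum, Finset.sum_range_succ, Finset.sum_range_succ, Finset.sum_range_one,
    baseTerm_zero, r1', r0']
  field_simp
  ring

theorem specialSum_six_mul_add_one {q : K} (hq : q ≠ 0) (hq1 : ∀ i : ℕ, 0 < i → 1 - q ^ i ≠ 0)
    (j : ℕ) {N : ℕ} (hN : 3 * j < N) :
    specialSum q (6 * j + 1) N * q ^ (3 * j) = 1 - q ^ (6 * j + 1) := by
  induction j with
  | zero => simpa using specialSum_one hq (by omega)
  | succ j ih =>
    have ih := ih (by omega)
    have h := specialSum_add_six (h := 3 * j) (N := N) hq hq1 (by omega)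
    rw [show 2 * (3 * j) + 1 = 6 * j + 1 by ring] at h
    rw [show 6 * (j + 1) + 1 = 6 * j + 1 + 6 by ring]
    apply mul_left_cancel₀ (hq1 (6 * j + 1) (by omega))
    rw [show q ^ (3 * (j + 1)) = q ^ (3 * j) * q ^ 3 by ring]
    linear_combination q ^ (3 * j) * h + (1 - q ^ (6 * j + 1 + 6)) * ih

theorem specialSum_six_mul_add_five {q : K} (hq : q ≠ 0) (hq1 : ∀ i : ℕ, 0 < i → 1 - q ^ i ≠ 0)
    (j : ℕ) {N : ℕ} (hN : 3 * j + 2 < N) :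
    specialSum q (6 * j + 5) N * q ^ (3 * j + 2) = -(1 - q ^ (6 * j + 5)) := by
  induction j with
  | zero => simpa using specialSum_five hq hq1 (by omega)
  | succ j ih =>
    have ih := ih (by omega)
    have h := specialSum_add_six (h := 3 * j + 2) (N := N) hq hq1 (by omega)
    rw [show 2 * (3 * j + 2) + 1 = 6 * j + 5 by ring] at h
    rw [show 6 * (j + 1) + 5 = 6 * j + 5 + 6 by ring]
    apply mul_left_cancel₀ (hq1 (6 * j + 5) (by omega))
    rw [show q ^ (3 * (j + 1) + 2) = q ^ (3 * j + 2) * q ^ 3 by ring]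
    linear_combination q ^ (3 * j + 2) * h + (1 - q ^ (6 * j + 5 + 6)) * ih

theorem exists_specialSum_eq {q : K} (hq : q ≠ 0) (hq1 : ∀ i : ℕ, 0 < i → 1 - q ^ i ≠ 0)
    {h : ℕ} (hh : Nat.Coprime (2 * h + 1) 6) :
    ∃ χ : ℤ, χ ^ 2 = 1 ∧ specialSum q (2 * h + 1) (2 * h + 1) * q ^ h =
      χ * (1 - q ^ (2 * h + 1)) := by
  have h3 : (2 * h + 1) % 3 ≠ 0 := fun h0 => by
    have : 3 ∣ Nat.gcd (2 * h + 1) 6 := Nat.dvd_gcd (Nat.dvd_of_mod_eq_zero h0) (by norm_num)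
    rw [hh] at this
    norm_num at this
  -- Since 3 does not divide `2h+1`, `h` is not 1 modulo 3; the two cases are `2h+1 = 6j+1` and
  -- `2h+1 = 6j+5`.
  rcases (by omega : h = 3 * (h / 3) ∨ h = 3 * (h / 3) + 2) with e | e
  · refine ⟨1, by norm_num, ?_⟩
    generalize h / 3 = j at e
    subst e
    rw [show 2 * (3 * j) + 1 = 6 * j + 1 by ring, specialSum_six_mul_add_one hq hq1 j (by omega)]
    simp
  · refine ⟨-1, by norm_num, ?_⟩
    generalize h / 3 = j at e
    subst e
    rw [show 2 * (3 * j + 2) + 1 = 6 * j + 5 by ring,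
      specialSum_six_mul_add_five hq hq1 j (by omega)]
    simp

end Evaluation

/-! ### Orders at cyclotomic polynomials -/

section Cyclotomic

variable {K : Type*} [Field K] [Algebra ℤ[X] K] [IsFractionRing ℤ[X] K] {d : ℕ}

theorem prime_cyclotomic (hd : 0 < d) : Prime (cyclotomic d ℤ) :=
  (cyclotomic.irreducible hd).prime

theorem cyclotomic_dvd_cyclotomic_iff (hd : 0 < d) {e : ℕ} (he : 0 < e) :
    cyclotomic d ℤ ∣ cyclotomic e ℤ ↔ d = e := by
  refine ⟨fun h => ?_, fun h => h ▸ dvd_rfl⟩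
  have := (cyclotomic.irreducible hd).associated_of_dvd (cyclotomic.irreducible he) h
  exact cyclotomic_injective (R := ℤ)
    (eq_of_monic_of_associated (cyclotomic.monic d ℤ) (cyclotomic.monic e ℤ) this)

theorem not_cyclotomic_dvd_X (hd : 0 < d) : ¬ cyclotomic d ℤ ∣ X := by
  intro h
  have h1 : cyclotomic d ℤ ∣ X ^ d - 1 := cyclotomic.dvd_X_pow_sub_one d ℤ
  have h2 : cyclotomic d ℤ ∣ 1 := by
    have := (h.trans (dvd_pow_self X hd.ne')).sub h1
    simpa using this
  exact (prime_cyclotomic hd).not_dvd_one h2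

theorem hasOrd_X (hd : 0 < d) : HasOrd (cyclotomic d ℤ) 0 (algebraMap ℤ[X] K X) :=
  hasOrd_algebraMap (prime_cyclotomic hd) (not_cyclotomic_dvd_X hd)

/-- `X^N - 1` is the product of the pairwise non-associated primes `Φ_i`, `i ∣ N`, each occurring
once. -/
theorem hasOrd_one_sub_pow (hd : 0 < d) {N : ℕ} (hN : 0 < N) :
    HasOrd (cyclotomic d ℤ) (if d ∣ N then 1 else 0) (1 - (algebraMap ℤ[X] K X) ^ N) := by
  have hp := prime_cyclotomic hd
  have key : ∀ s ⊆ N.divisors, d ∉ s → ¬ cyclotomic d ℤ ∣ -∏ i ∈ s, cyclotomic i ℤ := by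
    intro s hs hds h
    rw [dvd_neg, hp.dvd_finsetProd_iff] at h
    obtain ⟨e, he, hde⟩ := h
    rw [cyclotomic_dvd_cyclotomic_iff hd (Nat.pos_of_mem_divisors (hs he))] at hde
    exact hds (hde ▸ he)
  have e : 1 - (algebraMap ℤ[X] K X) ^ N = algebraMap ℤ[X] K (-(X ^ N - 1)) := by simp
  rw [e, ← prod_cyclotomic_eq_X_pow_sub_one hN ℤ]
  split_ifs with h
  · have hmem : d ∈ N.divisors := Nat.mem_divisors.2 ⟨h, hN.ne'⟩
    refine ⟨-∏ i ∈ N.divisors.erase d, cyclotomic i ℤ, 1,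
      key _ (Finset.erase_subset _ _) (by simp), hp.not_dvd_one, ?_⟩
    rw [← Finset.mul_prod_erase _ _ hmem]
    simp
  · exact hasOrd_algebraMap hp (key _ subset_rfl (by simp [h]))

theorem one_sub_X_pow_ne_zero {N : ℕ} (hN : 0 < N) :
    1 - (algebraMap ℤ[X] K X) ^ N ≠ 0 :=
  (hasOrd_one_sub_pow (d := 1) one_pos hN).ne_zero (prime_cyclotomic one_pos)

end Cyclotomic

/-! ### Orders of the terms of the series -/

section TermOrder

set_option linter.unusedSectionVars false

variable {K : Type*} [Field K] [Algebra ℤ[X] K] [IsFractionRing ℤ[X] K] {d h : ℕ}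

local notation "𝐪" => algebraMap ℤ[X] K X

/-- This counts multiples of `d` in `h+1, …, h+m`; there are none in `1, …, h` because `h < d`. -/
theorem sum_ite_dvd_succ_add (hd : h < d) (m : ℕ) :
    ∑ i ∈ Finset.range m, (if d ∣ i + h + 1 then 1 else 0 : ℤ) = ((m + h) / d : ℕ) := by
  induction m with
  | zero => simp [Nat.div_eq_of_lt hd]
  | succ m ih =>
    rw [Finset.sum_range_succ, ih, show m + 1 + h = m + h + 1 by ring, Nat.succ_div]
    push_cast
    rfl

/-- Modulo the odd number `d = 2h+1`, `2i+1 ≡ 2(i+h+1)`, so `d ∣ 2i+1` exactly when `d ∣ i+h+1`. -/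
theorem hasOrd_qPochhammer_odd (m : ℕ) :
    HasOrd (cyclotomic (2 * h + 1) ℤ) ((m + h) / (2 * h + 1) : ℕ)
      (qPochhammer 𝐪 (𝐪 ^ 2) m) := by
  rw [← sum_ite_dvd_succ_add (by omega), qPochhammer]
  refine HasOrd.prod (prime_cyclotomic (by omega)) _ fun i _ => ?_
  have := hasOrd_one_sub_pow (K := K) (d := 2 * h + 1) (by omega) (N := 2 * i + 1) (by omega)
  have e : (2 * h + 1 ∣ 2 * i + 1) ↔ (2 * h + 1 ∣ i + h + 1) := by
    rw [← Nat.dvd_add_right (dvd_refl (2 * h + 1)),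
      show 2 * h + 1 + (2 * i + 1) = 2 * (i + h + 1) by ring]
    exact Nat.Coprime.dvd_mul_left (by simp)
  rw [if_congr e rfl rfl] at this
  convert this using 1
  ring

theorem hasOrd_qPochhammer_self {c : ℕ} (hd : 0 < d) (hc : 0 < c) (hcd : Nat.Coprime d c) (m : ℕ) :
    HasOrd (cyclotomic d ℤ) (m / d : ℕ) (qPochhammer (𝐪 ^ c) (𝐪 ^ c) m) := by
  have := sum_ite_dvd_succ_add hd m
  simp only [add_zero] at this
  rw [← this, qPochhammer]
  refine HasOrd.prod (prime_cyclotomic hd) _ fun i _ => ?_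
  have := hasOrd_one_sub_pow (K := K) hd (N := c * (i + 1)) (by positivity)
  rw [if_congr (Nat.Coprime.dvd_mul_left hcd) rfl rfl] at this
  convert this using 1
  ring

theorem coprime_two_of_six (hd : Nat.Coprime d 6) : Nat.Coprime d 2 :=
  hd.coprime_dvd_right (by norm_num)

theorem hasOrd_baseTerm (hd : Nat.Coprime (2 * h + 1) 6) (k : ℕ) :
    HasOrd (cyclotomic (2 * h + 1) ℤ)
      (2 * ((k + h) / (2 * h + 1) : ℕ) + ((2 * k + h) / (2 * h + 1) : ℕ) -
        (2 * (k / (2 * h + 1) : ℕ) + (2 * k / (2 * h + 1) : ℕ)))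
      (baseTerm 𝐪 1 k) := by
  have hp : Prime (cyclotomic (2 * h + 1) ℤ) := prime_cyclotomic (by omega)
  have h1 := hasOrd_qPochhammer_odd (K := K) (h := h) k
  have h2 := hasOrd_qPochhammer_odd (K := K) (h := h) (2 * k)
  have h3 := hasOrd_qPochhammer_self (K := K) (d := 2 * h + 1) (by omega) (by omega) hd k
  have h4 := hasOrd_qPochhammer_self (K := K) (d := 2 * h + 1) (by omega) (by omega)
    (coprime_two_of_six hd) (2 * k)
  have h5 := (hasOrd_X (K := K) (d := 2 * h + 1) (by omega)).pow hp (2 * k ^ 2)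
  simp only [baseTerm, one_mul, div_one]
  convert (((h1.mul hp h1).mul hp h2).div hp ((h3.mul hp h3).mul hp h4)).mul hp h5 using 1
  ring

theorem hasOrdGE_X_pow (hd : 0 < d) (m : ℕ) : HasOrdGE (cyclotomic d ℤ) 0 (𝐪 ^ m) := by
  simpa using ((hasOrd_X (K := K) hd).pow (prime_cyclotomic hd) m).hasOrdGE

theorem hasOrdGE_one_sub_X_pow (hd : 0 < d) (m : ℕ) :
    HasOrdGE (cyclotomic d ℤ) 0 (1 - 𝐪 ^ m) :=
  (hasOrdGE_one (prime_cyclotomic hd)).sub (prime_cyclotomic hd) (hasOrdGE_X_pow hd m)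

theorem hasOrdGE_qInteger (hd : 0 < d) (m : ℕ) :
    HasOrdGE (cyclotomic d ℤ) 0 (qInteger 𝐪 m) :=
  HasOrdGE.sum (prime_cyclotomic hd) fun i _ => hasOrdGE_X_pow hd i

theorem hasOrd_one_sub_X (hd : 1 < d) : HasOrd (cyclotomic d ℤ) 0 (1 - 𝐪) := by
  have := hasOrd_one_sub_pow (K := K) (d := d) (by omega) one_pos
  rwa [if_neg (by rw [Nat.dvd_one]; omega), pow_one] at this

theorem hasOrdGE_one_sub_X_pow_of_dvd (hd : 0 < d) {m : ℕ} (hm : d ∣ m) :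
    HasOrdGE (cyclotomic d ℤ) 1 (1 - 𝐪 ^ m) := by
  rcases Nat.eq_zero_or_pos m with rfl | h0
  · simpa using hasOrdGE_zero (prime_cyclotomic hd) 1
  · have := hasOrd_one_sub_pow (K := K) (d := d) hd h0
    rw [if_pos hm] at this
    exact this.hasOrdGE

theorem qInteger_mul_one_sub {K : Type*} [Field K] (q : K) (n : ℕ) : qInteger q n * (1 - q) = 1 - q ^ n :=
  geom_sum_mul_neg q n

theorem hasOrdGE_qInteger_of_dvd (hd : 1 < d) {m : ℕ} (hm : d ∣ m) :
    HasOrdGE (cyclotomic d ℤ) 1 (qInteger 𝐪 m) := by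
  refine HasOrdGE.of_mul_right (prime_cyclotomic (by omega)) ?_ (hasOrd_one_sub_X hd)
  rw [qInteger_mul_one_sub]
  exact hasOrdGE_one_sub_X_pow_of_dvd (by omega) hm

theorem hasOrdGE_baseTerm (hd : Nat.Coprime (2 * h + 1) 6) (k : ℕ) :
    HasOrdGE (cyclotomic (2 * h + 1) ℤ) 0 (baseTerm 𝐪 1 k) := by
  refine (hasOrd_baseTerm hd k).hasOrdGE.mono (prime_cyclotomic (by omega)) ?_
  have h1 : k / (2 * h + 1) ≤ (k + h) / (2 * h + 1) := Nat.div_le_div_right (by omega)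
  have h2 : 2 * k / (2 * h + 1) ≤ (2 * k + h) / (2 * h + 1) := Nat.div_le_div_right (by omega)
  omega

theorem hasOrdGE_two_baseTerm (hd : Nat.Coprime (2 * h + 1) 6) (u : ℕ) {r : ℕ} (hr : h < r)
    (hr' : r < 2 * h + 1) :
    HasOrdGE (cyclotomic (2 * h + 1) ℤ) 2 (baseTerm 𝐪 1 ((2 * h + 1) * u + r)) := by
  refine (hasOrd_baseTerm hd _).hasOrdGE.mono (prime_cyclotomic (by omega)) ?_
  have h1 : ((2 * h + 1) * u + r) / (2 * h + 1) = u := by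
    rw [Nat.mul_add_div (by omega), Nat.div_eq_of_lt hr', add_zero]
  have h2 : u + 1 ≤ ((2 * h + 1) * u + r + h) / (2 * h + 1) := by
    rw [Nat.le_div_iff_mul_le (by omega)]; nlinarith
  have h3 : 2 * ((2 * h + 1) * u + r) / (2 * h + 1) ≤
      (2 * ((2 * h + 1) * u + r) + h) / (2 * h + 1) := Nat.div_le_div_right (by omega)
  omega

theorem hasOrdGE_cTerm_of_baseTerm {m : ℤ} {k : ℕ} (hd : 0 < d)
    (hb : HasOrdGE (cyclotomic d ℤ) m (baseTerm 𝐪 1 k)) :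
    HasOrdGE (cyclotomic d ℤ) m (cTerm 𝐪 k) := by
  rw [cTerm_eq]
  exact hb.mul_right (prime_cyclotomic hd) (hasOrdGE_qInteger hd _)

theorem hasOrdGE_cTerm (hd : Nat.Coprime (2 * h + 1) 6) (k : ℕ) :
    HasOrdGE (cyclotomic (2 * h + 1) ℤ) 0 (cTerm 𝐪 k) :=
  hasOrdGE_cTerm_of_baseTerm (by omega) (hasOrdGE_baseTerm hd k)

theorem hasOrdGE_one_cTerm (hd : Nat.Coprime (2 * h + 1) 6) {k : ℕ} (hk : h < 2 * k)
    (hk' : k ≤ h) : HasOrdGE (cyclotomic (2 * h + 1) ℤ) 1 (cTerm 𝐪 k) := by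
  refine hasOrdGE_cTerm_of_baseTerm (by omega) ((hasOrd_baseTerm hd k).hasOrdGE.mono
    (prime_cyclotomic (by omega)) ?_)
  have h1 : k / (2 * h + 1) = 0 := Nat.div_eq_of_lt (by omega)
  have h2 : 2 * k / (2 * h + 1) = 0 := Nat.div_eq_of_lt (by omega)
  have h3 : 1 ≤ (2 * k + h) / (2 * h + 1) := by
    rw [Nat.le_div_iff_mul_le (by omega)]; omega
  have h4 : 0 ≤ (k + h) / (2 * h + 1) := Nat.zero_le _
  omega

theorem hasOrdGE_three_cTerm (hd : Nat.Coprime (2 * h + 1) 6) {k : ℕ} (hk : 3 * h + 2 ≤ 2 * k)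
    (hk' : k < 2 * h + 1) : HasOrdGE (cyclotomic (2 * h + 1) ℤ) 3 (cTerm 𝐪 k) := by
  refine hasOrdGE_cTerm_of_baseTerm (by omega) ((hasOrd_baseTerm hd k).hasOrdGE.mono
    (prime_cyclotomic (by omega)) ?_)
  have h1 : k / (2 * h + 1) = 0 := Nat.div_eq_of_lt (by omega)
  have h2 : 2 * k / (2 * h + 1) < 2 := Nat.div_lt_of_lt_mul (by omega)
  have h3 : 2 ≤ (2 * k + h) / (2 * h + 1) := by
    rw [Nat.le_div_iff_mul_le (by omega)]; omega
  have h4 : 1 ≤ (k + h) / (2 * h + 1) := by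
    rw [Nat.le_div_iff_mul_le (by omega)]; omega
  omega

theorem hasOrdGE_two_cTerm (hd : Nat.Coprime (2 * h + 1) 6) {k : ℕ} (hk : h < k)
    (hk' : k < 2 * h + 1) : HasOrdGE (cyclotomic (2 * h + 1) ℤ) 2 (cTerm 𝐪 k) :=
  hasOrdGE_cTerm_of_baseTerm (by omega) (by simpa using hasOrdGE_two_baseTerm hd 0 hk hk')

/-- Take `j ≤ i`, so `i > h` and `c(i)` has order at least 2. If `2j ≤ h`, then `2i ≥ 3h+2` and
`c(i)` alone has order 3; otherwise `c(j)` contributes at least 1. -/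
theorem hasOrdGE_three_cTerm_mul_cTerm (hd : Nat.Coprime (2 * h + 1) 6) {i j : ℕ}
    (hi : i < 2 * h + 1) (hj : j < 2 * h + 1) (hij : 2 * h + 1 ≤ i + j) :
    HasOrdGE (cyclotomic (2 * h + 1) ℤ) 3 (cTerm 𝐪 i * cTerm 𝐪 j) := by
  wlog hle : j ≤ i generalizing i j
  · rw [mul_comm (cTerm 𝐪 i)]
    exact this hj hi (by omega) (by omega)
  have hp : Prime (cyclotomic (2 * h + 1) ℤ) := prime_cyclotomic (by omega)
  by_cases h1 : 2 * j ≤ h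
  · exact (hasOrdGE_three_cTerm hd (by omega) hi).mul_right hp (hasOrdGE_cTerm hd j)
  have h2 := hasOrdGE_two_cTerm (K := K) hd (by omega) hi
  by_cases h3 : j ≤ h
  · exact h2.mul hp (hasOrdGE_one_cTerm hd (by omega) h3)
  · exact (h2.mul hp (hasOrdGE_two_cTerm hd (by omega) hj)).mono hp (by norm_num)

end TermOrder

/-! ### Congruences between terms and for the truncated series -/

section Congruence

variable {K : Type*} [Field K] [Algebra ℤ[X] K] [IsFractionRing ℤ[X] K] {d h : ℕ}

local notation "𝐪" => algebraMap ℤ[X] K X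

/-- The order at `Φ_d` of `q^i - q^j` is positive when `i ≡ j` modulo `d`. -/
theorem hasOrdGE_X_pow_sub_X_pow (hd : 0 < d) {i t : ℕ} (ht : d ∣ t) :
    HasOrdGE (cyclotomic d ℤ) 1 (𝐪 ^ i - 𝐪 ^ (i + t)) := by
  rw [show 𝐪 ^ i - 𝐪 ^ (i + t) = 𝐪 ^ i * (1 - 𝐪 ^ t) by ring]
  exact (hasOrdGE_X_pow hd i).mul_left (prime_cyclotomic hd) (hasOrdGE_one_sub_X_pow_of_dvd hd ht)

theorem hasOrdGE_one_sub_X_pow_sub (hd : 0 < d) {i t : ℕ} (ht : d ∣ t) :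
    HasOrdGE (cyclotomic d ℤ) 1 ((1 - 𝐪 ^ i) - (1 - 𝐪 ^ (i + t))) := by
  rw [show (1 - 𝐪 ^ i) - (1 - 𝐪 ^ (i + t)) = -(𝐪 ^ i - 𝐪 ^ (i + t)) by ring]
  exact (hasOrdGE_X_pow_sub_X_pow hd ht).neg

theorem baseDen_one_ne_zero (k : ℕ) : baseDen 𝐪 1 k ≠ 0 := by
  simp only [baseDen, one_mul, div_one, mul_ne_zero_iff]
  exact ⟨⟨⟨one_sub_X_pow_ne_zero (by omega), one_sub_X_pow_ne_zero (by omega)⟩,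
    one_sub_X_pow_ne_zero (by omega)⟩, one_sub_X_pow_ne_zero (by omega)⟩

/-- The exponents are `6(k+1)`, `2(2k+1)`, `2(2k+2)`. Coprimality to 6 removes the constants, and `k
< h` keeps the other factors below `d`. -/
theorem hasOrd_baseDen (hd : Nat.Coprime (2 * h + 1) 6) {k : ℕ} (hk : k < h) :
    HasOrd (cyclotomic (2 * h + 1) ℤ) 0 (baseDen 𝐪 1 k) := by
  have hp : Prime (cyclotomic (2 * h + 1) ℤ) := prime_cyclotomic (by omega)
  have key : ∀ c i : ℕ, 0 < c → Nat.Coprime (2 * h + 1) c → 0 < i → i < 2 * h + 1 →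
      HasOrd (cyclotomic (2 * h + 1) ℤ) 0 (1 - 𝐪 ^ (c * i)) := by
    intro c i hc hcd hi hi'
    have := hasOrd_one_sub_pow (K := K) (d := 2 * h + 1) (by omega) (N := c * i) (by positivity)
    rwa [if_neg] at this
    rw [hcd.dvd_mul_left]
    exact Nat.not_dvd_of_pos_of_lt hi hi'
  have h6 := key 6 (k + 1) (by omega) hd (by omega) (by omega)
  have h2 := key 2 (2 * k + 1) (by omega) (coprime_two_of_six hd) (by omega) (by omega)
  have h4 := key 2 (2 * k + 2) (by omega) (coprime_two_of_six hd) (by omega) (by omega)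
  simp only [baseDen, one_mul, div_one]
  convert ((h6.mul hp h6).mul hp h2).mul hp h4 using 2 <;> ring

theorem hasOrdGE_baseNum (hd : 0 < d) (k : ℕ) :
    HasOrdGE (cyclotomic d ℤ) 0 (baseNum 𝐪 1 k) := by
  have hp := prime_cyclotomic hd
  simp only [baseNum, one_mul, div_one]
  exact ((((hasOrdGE_one_sub_X_pow hd _).mul_left hp (hasOrdGE_one_sub_X_pow hd _)).mul_left hp
    (hasOrdGE_one_sub_X_pow hd _)).mul_left hp (hasOrdGE_one_sub_X_pow hd _)).mul_left hp
    (hasOrdGE_X_pow hd _)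

/-- A Lucas-type congruence modulo `Φ_d`. -/
theorem hasOrdGE_baseTerm_sub (hd : Nat.Coprime (2 * h + 1) 6) (u : ℕ) {r : ℕ} (hr : r ≤ h) :
    HasOrdGE (cyclotomic (2 * h + 1) ℤ) 1
      (baseTerm 𝐪 1 ((2 * h + 1) * u) * baseTerm 𝐪 1 r -
        baseTerm 𝐪 1 ((2 * h + 1) * u + r)) := by
  have hd0 : 0 < 2 * h + 1 := by omega
  have hp : Prime (cyclotomic (2 * h + 1) ℤ) := prime_cyclotomic hd0
  have diff : ∀ i j c : ℕ, j = i + (2 * h + 1) * c →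
      HasOrdGE (cyclotomic (2 * h + 1) ℤ) 1 ((1 - 𝐪 ^ i) - (1 - 𝐪 ^ j)) := by
    rintro i j c rfl
    exact hasOrdGE_one_sub_X_pow_sub hd0 (dvd_mul_right _ _)
  have diff' : ∀ i j c : ℕ, j = i + (2 * h + 1) * c →
      HasOrdGE (cyclotomic (2 * h + 1) ℤ) 1 (𝐪 ^ i - 𝐪 ^ j) := by
    rintro i j c rfl
    exact hasOrdGE_X_pow_sub_X_pow hd0 (dvd_mul_right _ _)
  have int := fun i => hasOrdGE_one_sub_X_pow (K := K) hd0 i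
  refine hasOrdGE_sub_of_recurrence hp le_rfl (N := h)
    (e := fun k => baseTerm 𝐪 1 ((2 * h + 1) * u) * baseTerm 𝐪 1 k)
    (e' := fun k => baseTerm 𝐪 1 ((2 * h + 1) * u + k))
    (num := baseNum 𝐪 1) (num' := fun k => baseNum 𝐪 1 ((2 * h + 1) * u + k))
    (den := baseDen 𝐪 1) (den' := fun k => baseDen 𝐪 1 ((2 * h + 1) * u + k))
    ?_ ?_ ?_ ?_ ?_ ?_ ?_ ?_ r hr
  · intro k _
    rw [mul_assoc, mul_assoc, baseTerm_succ _ _ _ (baseDen_one_ne_zero k)]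
  · intro k _
    exact baseTerm_succ _ _ _ (baseDen_one_ne_zero _)
  · simpa [baseTerm_zero] using hasOrdGE_zero hp 1
  · intro k _
    exact (hasOrdGE_baseTerm hd _).mul_left hp (hasOrdGE_baseTerm hd _)
  · intro k _
    simp only [baseNum, one_mul, div_one]
    have e1 := diff (2 * k + 1) (2 * ((2 * h + 1) * u + k) + 1) (2 * u) (by ring)
    have e2 := diff (4 * k + 1) (4 * ((2 * h + 1) * u + k) + 1) (4 * u) (by ring)
    have e3 := diff (4 * k + 3) (4 * ((2 * h + 1) * u + k) + 3) (4 * u) (by ring)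
    have e4 := diff' (4 * k + 2) (4 * ((2 * h + 1) * u + k) + 2) (4 * u) (by ring)
    exact HasOrdGE.mul_sub_mul hp (HasOrdGE.mul_sub_mul hp (HasOrdGE.mul_sub_mul hp
      (HasOrdGE.mul_sub_mul hp e1 e1 (int _) (int _)) e2 ((int _).mul_left hp (int _)) (int _))
      e3 (((int _).mul_left hp (int _)).mul_left hp (int _)) (int _)) e4
      ((((int _).mul_left hp (int _)).mul_left hp (int _)).mul_left hp (int _))
      (hasOrdGE_X_pow hd0 _)
  · intro k _
    simp only [baseDen, one_mul, div_one]
    have e1 := diff (6 * k + 6) (6 * ((2 * h + 1) * u + k) + 6) (6 * u) (by ring)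
    have e2 := diff (4 * k + 2) (4 * ((2 * h + 1) * u + k) + 2) (4 * u) (by ring)
    have e3 := diff (4 * k + 4) (4 * ((2 * h + 1) * u + k) + 4) (4 * u) (by ring)
    exact HasOrdGE.mul_sub_mul hp (HasOrdGE.mul_sub_mul hp
      (HasOrdGE.mul_sub_mul hp e1 e1 (int _) (int _)) e2 ((int _).mul_left hp (int _)) (int _))
      e3 (((int _).mul_left hp (int _)).mul_left hp (int _)) (int _)
  · intro k _
    exact hasOrdGE_baseNum hd0 k
  · intro k hk
    exact hasOrd_baseDen hd hk

/-- For `r ≤ h` this is the Lucas-type congruence; for `r > h` both terms already vanish modulo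
`Φ_d²`. -/
theorem hasOrdGE_cTerm_sub (hd : Nat.Coprime (2 * h + 1) 6) (hh : 0 < h) (u : ℕ) {r : ℕ}
    (hr : r < 2 * h + 1) :
    HasOrdGE (cyclotomic (2 * h + 1) ℤ) 1
      (baseTerm 𝐪 1 ((2 * h + 1) * u) * cTerm 𝐪 r - cTerm 𝐪 ((2 * h + 1) * u + r)) := by
  have hd0 : 0 < 2 * h + 1 := by omega
  have hp : Prime (cyclotomic (2 * h + 1) ℤ) := prime_cyclotomic hd0
  rcases le_or_gt r h with hr' | hr'
  · rw [cTerm_eq, cTerm_eq, ← mul_assoc]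
    refine HasOrdGE.mul_sub_mul hp (hasOrdGE_baseTerm_sub hd u hr') ?_
      (hasOrdGE_baseTerm hd _) (hasOrdGE_qInteger hd0 _)
    refine HasOrdGE.of_mul_right hp ?_ (hasOrd_one_sub_X (by omega))
    rw [sub_mul, qInteger_mul_one_sub, qInteger_mul_one_sub,
      show 8 * ((2 * h + 1) * u + r) + 1 = 8 * r + 1 + (2 * h + 1) * (8 * u) by ring]
    exact hasOrdGE_one_sub_X_pow_sub hd0 (dvd_mul_right _ _)
  · refine HasOrdGE.mono hp (m := 2) (by norm_num) ?_
    exact ((hasOrdGE_baseTerm hd _).mul_left hp (hasOrdGE_two_cTerm hd hr' hr)).sub hp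
      (hasOrdGE_cTerm_of_baseTerm hd0 (hasOrdGE_two_baseTerm hd u hr' hr))

/-- `(1 - a q^m)(1 - q^m / a)` agrees with `(1 - q^m)²` modulo `Φ_d²` at `a = q^d`. -/
theorem hasOrdGE_two_sub_deformed (hd : 0 < d) (m : ℕ) :
    HasOrdGE (cyclotomic d ℤ) 2 ((1 - 1 * 𝐪 ^ m) * (1 - 𝐪 ^ m / 1) -
      (1 - 𝐪 ^ d * 𝐪 ^ m) * (1 - 𝐪 ^ m / 𝐪 ^ d)) := by
  have hp := prime_cyclotomic hd
  have hq : 𝐪 ≠ 0 := (hasOrd_X (K := K) hd).ne_zero hp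
  have e : (1 - 1 * 𝐪 ^ m) * (1 - 𝐪 ^ m / 1) - (1 - 𝐪 ^ d * 𝐪 ^ m) * (1 - 𝐪 ^ m / 𝐪 ^ d) =
      𝐪 ^ m / 𝐪 ^ d * ((1 - 𝐪 ^ d) * (1 - 𝐪 ^ d)) := by
    field_simp
    ring
  rw [e]
  have h1 := ((hasOrd_X (K := K) hd).pow hp m).div hp ((hasOrd_X (K := K) hd).pow hp d)
  have h2 := hasOrdGE_one_sub_X_pow_of_dvd (K := K) hd (dvd_refl d)
  exact HasOrdGE.mul_left hp (by simpa using h1.hasOrdGE) (h2.mul hp h2)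

/-- For `k > h` the deformed term is zero and the original has order at least 2; for `k ≤ h` the
term ratios are compared. -/
theorem hasOrdGE_two_baseTerm_sub (hd : Nat.Coprime (2 * h + 1) 6) {k : ℕ}
    (hk : k < 2 * h + 1) : HasOrdGE (cyclotomic (2 * h + 1) ℤ) 2
      (baseTerm 𝐪 1 k - baseTerm 𝐪 (𝐪 ^ (2 * h + 1)) k) := by
  have hd0 : 0 < 2 * h + 1 := by omega
  have hp : Prime (cyclotomic (2 * h + 1) ℤ) := prime_cyclotomic hd0
  have hq : 𝐪 ≠ 0 := (hasOrd_X (K := K) hd0).ne_zero hp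
  have int := fun i => hasOrdGE_one_sub_X_pow (K := K) hd0 i
  rcases le_or_gt k h with hk' | hk'
  swap
  · rw [baseTerm_eq_zero hq hk', sub_zero]
    simpa using hasOrdGE_two_baseTerm hd 0 hk' hk
  refine hasOrdGE_sub_of_recurrence hp (by norm_num) (N := h)
    (num := baseNum 𝐪 1) (num' := baseNum 𝐪 (𝐪 ^ (2 * h + 1)))
    (den := baseDen 𝐪 1) (den' := baseDen 𝐪 (𝐪 ^ (2 * h + 1)))
    ?_ ?_ ?_ ?_ ?_ ?_ ?_ ?_ k hk'
  · intro k _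
    exact baseTerm_succ _ _ _ (baseDen_one_ne_zero k)
  · intro k _
    refine baseTerm_succ _ _ _ ?_
    -- `6k+6` is even and `2h+1` is odd, so the two powers differ.
    have hs : 1 - 𝐪 ^ (6 * k + 6) / 𝐪 ^ (2 * h + 1) ≠ 0 := by
      rw [one_sub_div (pow_ne_zero _ hq)]
      exact div_ne_zero (pow_sub_pow_ne_zero hq (fun i hi => one_sub_X_pow_ne_zero hi) (by omega))
        (pow_ne_zero _ hq)
    simp only [baseDen, mul_ne_zero_iff, ← pow_add]
    exact ⟨⟨⟨one_sub_X_pow_ne_zero (by omega), hs⟩, one_sub_X_pow_ne_zero (by omega)⟩,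
      one_sub_X_pow_ne_zero (by omega)⟩
  · simpa [baseTerm_zero] using hasOrdGE_zero hp 2
  · intro k _
    exact hasOrdGE_baseTerm hd _
  · intro k _
    simp only [baseNum, ← sub_mul]
    exact (((hasOrdGE_two_sub_deformed hd0 _).mul_right hp (int _)).mul_right hp
      (int _)).mul_right hp (hasOrdGE_X_pow hd0 _)
  · intro k _
    simp only [baseDen, ← sub_mul]
    exact ((hasOrdGE_two_sub_deformed hd0 _).mul_right hp (int _)).mul_right hp (int _)
  · intro k _
    exact hasOrdGE_baseNum hd0 k
  · intro k hk
    exact hasOrd_baseDen hd hk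

/-- The `q`-supercongruence for the partial sum of the series itself. -/
theorem exists_hasOrdGE_two_sum_cTerm_sub (hd : Nat.Coprime (2 * h + 1) 6) (hh : 0 < h) :
    ∃ χ : ℤ, χ ^ 2 = 1 ∧ HasOrdGE (cyclotomic (2 * h + 1) ℤ) 2
      (∑ k ∈ Finset.range (2 * h + 1), cTerm 𝐪 k - χ * qInteger 𝐪 (2 * h + 1) / 𝐪 ^ h) := by
  have hd0 : 0 < 2 * h + 1 := by omega
  have hp : Prime (cyclotomic (2 * h + 1) ℤ) := prime_cyclotomic hd0
  have hq : 𝐪 ≠ 0 := (hasOrd_X (K := K) hd0).ne_zero hp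
  obtain ⟨χ, hχ, hsum⟩ := exists_specialSum_eq hq
    (fun i hi => one_sub_X_pow_ne_zero (K := K) hi) hd
  refine ⟨χ, hχ, HasOrdGE.of_mul_right hp ?_ (hasOrd_one_sub_X (by omega))⟩
  rw [← eq_div_iff (pow_ne_zero _ hq)] at hsum
  have e : (∑ k ∈ Finset.range (2 * h + 1), cTerm 𝐪 k -
      χ * qInteger 𝐪 (2 * h + 1) / 𝐪 ^ h) * (1 - 𝐪) =
      ∑ k ∈ Finset.range (2 * h + 1),
        (baseTerm 𝐪 1 k - baseTerm 𝐪 (𝐪 ^ (2 * h + 1)) k) * (1 - 𝐪 ^ (8 * k + 1)) := by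
    simp only [sub_mul _ _ (1 - 𝐪 ^ _)]
    rw [Finset.sum_sub_distrib]
    change _ = _ - specialSum 𝐪 (2 * h + 1) (2 * h + 1)
    rw [hsum, sub_mul, Finset.sum_mul, ← qInteger_mul_one_sub, mul_div_right_comm, mul_div_right_comm,
      mul_assoc]
    congr 1
    refine Finset.sum_congr rfl fun k _ => ?_
    rw [cTerm_eq, mul_assoc, qInteger_mul_one_sub]
  rw [e]
  exact HasOrdGE.sum hp fun k hk => (hasOrdGE_two_baseTerm_sub hd (Finset.mem_range.1 hk)).mul_right
    hp (hasOrdGE_one_sub_X_pow hd0 _)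

end Congruence

/-! ### Partial sums of the squared series -/

section Square

variable {K : Type*} [Field K]

theorem sum_aTerm_eq (q : K) (n : ℕ) :
    ∑ k ∈ Finset.range n, aTerm q k = ∑ i ∈ Finset.range n, ∑ j ∈ Finset.range n,
      if i + j < n then cTerm q i * cTerm q j else 0 := by
  simp only [aTerm]
  rw [Finset.sum_range_diag_flip n fun i j => cTerm q i * cTerm q j]
  refine Finset.sum_congr rfl fun i _ => ?_
  rw [← Finset.sum_filter]
  refine Finset.sum_congr ?_ fun _ _ => rfl
  ext j
  simp only [Finset.mem_range, Finset.mem_filter]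
  omega

theorem sum_range_mul_eq {M : Type*} [AddCommMonoid M] (d m : ℕ) (f : ℕ → M) :
    ∑ i ∈ Finset.range (d * m), f i =
      ∑ u ∈ Finset.range m, ∑ r ∈ Finset.range d, f (d * u + r) := by
  induction m with
  | zero => simp
  | succ m ih => rw [Nat.mul_succ, Finset.sum_range_add, ih, Finset.sum_range_succ]

variable [Algebra ℤ[X] K] [IsFractionRing ℤ[X] K] {h : ℕ}

local notation "𝐪" => algebraMap ℤ[X] K X

theorem hasOrdGE_three_sum_aTerm_sub_sq (hd : Nat.Coprime (2 * h + 1) 6) :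
    HasOrdGE (cyclotomic (2 * h + 1) ℤ) 3 (∑ k ∈ Finset.range (2 * h + 1), aTerm 𝐪 k -
      (∑ k ∈ Finset.range (2 * h + 1), cTerm 𝐪 k) ^ 2) := by
  have hp : Prime (cyclotomic (2 * h + 1) ℤ) := prime_cyclotomic (by omega)
  rw [sum_aTerm_eq, pow_two, Finset.sum_mul_sum, ← Finset.sum_sub_distrib]
  refine HasOrdGE.sum hp fun i hi => ?_
  rw [← Finset.sum_sub_distrib]
  refine HasOrdGE.sum hp fun j hj => ?_
  rw [Finset.mem_range] at hi hj
  split_ifs with hij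
  · simpa using hasOrdGE_zero hp 3
  · simpa using (hasOrdGE_three_cTerm_mul_cTerm (K := K) hd hi hj (by omega)).neg

theorem hasOrdGE_one_qInteger_div (hh : 0 < h) (χ : ℤ) :
    HasOrdGE (cyclotomic (2 * h + 1) ℤ) 1 (χ * qInteger 𝐪 (2 * h + 1) / 𝐪 ^ h) := by
  have hp : Prime (cyclotomic (2 * h + 1) ℤ) := prime_cyclotomic (by omega)
  rw [div_eq_mul_inv]
  refine HasOrdGE.mul_right hp ((hasOrdGE_intCast hp χ).mul_left hp
    (hasOrdGE_qInteger_of_dvd (by omega) dvd_rfl)) ?_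
  simpa using ((hasOrd_X (K := K) (d := 2 * h + 1) (by omega)).pow hp h).inv.hasOrdGE

theorem hasOrdGE_one_sum_cTerm (hd : Nat.Coprime (2 * h + 1) 6) (hh : 0 < h) :
    HasOrdGE (cyclotomic (2 * h + 1) ℤ) 1 (∑ k ∈ Finset.range (2 * h + 1), cTerm 𝐪 k) := by
  have hp : Prime (cyclotomic (2 * h + 1) ℤ) := prime_cyclotomic (by omega)
  obtain ⟨χ, -, hχ⟩ := exists_hasOrdGE_two_sum_cTerm_sub (K := K) hd hh
  simpa using (hχ.mono hp (by norm_num : (1 : ℤ) ≤ 2)).add hp (hasOrdGE_one_qInteger_div hh χ)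

theorem hasOrdGE_three_sum_aTerm_sub (hd : Nat.Coprime (2 * h + 1) 6) (hh : 0 < h) :
    HasOrdGE (cyclotomic (2 * h + 1) ℤ) 3 (∑ k ∈ Finset.range (2 * h + 1), aTerm 𝐪 k -
      qInteger 𝐪 (2 * h + 1) ^ 2 / 𝐪 ^ (2 * h)) := by
  have hp : Prime (cyclotomic (2 * h + 1) ℤ) := prime_cyclotomic (by omega)
  obtain ⟨χ, hχ1, hχ⟩ := exists_hasOrdGE_two_sum_cTerm_sub (K := K) hd hh
  have h1 := (hasOrdGE_one_sum_cTerm (K := K) hd hh).add hp (hasOrdGE_one_qInteger_div hh χ)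
  -- The difference of squares is `(S - T)(S + T)`, of order at least `2 + 1`.
  have h2 := (hasOrdGE_three_sum_aTerm_sub_sq (K := K) hd).add hp (hχ.mul hp h1)
  have hχ2 : (χ : K) ^ 2 = 1 := by exact_mod_cast congrArg (Int.cast (R := K)) hχ1
  convert h2 using 1
  have e : qInteger 𝐪 (2 * h + 1) ^ 2 / 𝐪 ^ (2 * h) =
      (χ * qInteger 𝐪 (2 * h + 1) / 𝐪 ^ h) ^ 2 := by
    rw [div_pow, mul_pow, hχ2, one_mul, ← pow_mul, mul_comm h 2]
  rw [e]
  ring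

/-- Write indices as `du+r` and `dv+s`. Modulo `Φ_d` the sum becomes `S²` times the sum of `b u * b
v` over `u + v < m`, and `S` is divisible by `Φ_d`. -/
theorem hasOrdGE_one_sum_aTerm (hd : Nat.Coprime (2 * h + 1) 6) (hh : 0 < h) (m : ℕ) :
    HasOrdGE (cyclotomic (2 * h + 1) ℤ) 1
      (∑ k ∈ Finset.range ((2 * h + 1) * m), aTerm 𝐪 k) := by
  have hp : Prime (cyclotomic (2 * h + 1) ℤ) := prime_cyclotomic (by omega)
  set d := 2 * h + 1 with hd_def
  set b : ℕ → K := fun u => baseTerm 𝐪 1 (d * u) with hb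
  set S := ∑ k ∈ Finset.range d, cTerm 𝐪 k with hS
  have hS1 : HasOrdGE (cyclotomic d ℤ) 1 S := hasOrdGE_one_sum_cTerm hd hh
  have hb0 : ∀ u, HasOrdGE (cyclotomic d ℤ) 0 (b u) := fun u => hasOrdGE_baseTerm hd _
  have hc0 : ∀ k, HasOrdGE (cyclotomic d ℤ) 0 (cTerm 𝐪 k) := fun k => hasOrdGE_cTerm hd _
  have main : HasOrdGE (cyclotomic d ℤ) 1
      (∑ u ∈ Finset.range m, ∑ v ∈ Finset.range m, (if u + v < m then b u * b v else 0) * (S * S)) :=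
    HasOrdGE.sum hp fun u _ => HasOrdGE.sum hp fun v _ => by
      refine HasOrdGE.mul_left hp ?_ ((hS1.mul hp hS1).mono hp (by norm_num))
      split_ifs
      · exact (hb0 u).mul_left hp (hb0 v)
      · exact hasOrdGE_zero hp 0
  have e : ∑ k ∈ Finset.range (d * m), aTerm 𝐪 k = ∑ u ∈ Finset.range m, ∑ v ∈ Finset.range m,
      ∑ r ∈ Finset.range d, ∑ s ∈ Finset.range d, if d * u + r + (d * v + s) < d * m then
        cTerm 𝐪 (d * u + r) * cTerm 𝐪 (d * v + s) else 0 := by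
    rw [sum_aTerm_eq]
    simp only [sum_range_mul_eq]
    exact Finset.sum_congr rfl fun u _ => Finset.sum_comm
  rw [← sub_add_cancel (∑ k ∈ Finset.range (d * m), aTerm 𝐪 k) (∑ u ∈ Finset.range m,
    ∑ v ∈ Finset.range m, (if u + v < m then b u * b v else 0) * (S * S))]
  refine HasOrdGE.add hp ?_ main
  rw [e, ← Finset.sum_sub_distrib]
  refine HasOrdGE.sum hp fun u _ => ?_
  rw [← Finset.sum_sub_distrib]
  refine HasOrdGE.sum hp fun v _ => ?_
  rw [hS, Finset.sum_mul_sum, Finset.mul_sum, ← Finset.sum_sub_distrib]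
  refine HasOrdGE.sum hp fun r hr => ?_
  rw [Finset.mul_sum, ← Finset.sum_sub_distrib]
  refine HasOrdGE.sum hp fun s hs => ?_
  rw [Finset.mem_range] at hr hs
  have diff : HasOrdGE (cyclotomic d ℤ) 1 (b u * cTerm 𝐪 r * (b v * cTerm 𝐪 s) -
      cTerm 𝐪 (d * u + r) * cTerm 𝐪 (d * v + s)) :=
    HasOrdGE.mul_sub_mul hp (hasOrdGE_cTerm_sub hd hh u hr) (hasOrdGE_cTerm_sub hd hh v hs)
      (hc0 _) ((hb0 v).mul_left hp (hc0 s))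
  -- Without a carry the truncation depends only on `u + v < m`. With a carry both products vanish
  -- modulo `Φ_d`, so the truncation is irrelevant.
  by_cases hrs : r + s < d
  · have hiff : d * u + r + (d * v + s) < d * m ↔ u + v < m := by
      constructor
      · intro hlt
        exact lt_of_mul_lt_mul_left (by nlinarith : d * (u + v) < d * m) (Nat.zero_le d)
      · intro hlt
        nlinarith [Nat.mul_le_mul_left d (Nat.succ_le_of_lt hlt)]
    rw [if_congr hiff rfl rfl]
    split_ifs
    · convert diff.neg using 1; ring
    · simpa using hasOrdGE_zero hp 1
  · have h1 : HasOrdGE (cyclotomic d ℤ) 1 (cTerm 𝐪 r * cTerm 𝐪 s) :=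
      (hasOrdGE_three_cTerm_mul_cTerm hd hr hs (by omega)).mono hp (by norm_num)
    have h2 : HasOrdGE (cyclotomic d ℤ) 1 (cTerm 𝐪 (d * u + r) * cTerm 𝐪 (d * v + s)) := by
      convert (((hb0 u).mul_left hp (hb0 v)).mul_left hp h1).sub hp diff using 1
      ring
    refine HasOrdGE.sub hp ?_ (HasOrdGE.mul_left hp ?_ h1)
    · split_ifs
      · exact h2
      · exact hasOrdGE_zero hp 1
    · split_ifs
      · exact (hb0 u).mul_left hp (hb0 v)
      · exact hasOrdGE_zero hp 0

end Square

/-! ### From orders to the congruence -/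

section Assembly

theorem isRelPrime_cyclotomic {d e : ℕ} (hd : 0 < d) (he : 0 < e) (hde : d ≠ e) :
    IsRelPrime (cyclotomic d ℤ) (cyclotomic e ℤ) :=
  (cyclotomic.irreducible hd).isRelPrime_iff_not_dvd.2
    (mt (cyclotomic_dvd_cyclotomic_iff hd he).1 hde)

/-- The reduced fraction of `A - B` serves as witness: every `Φ_d` in the modulus divides its
numerator, hence is coprime to its denominator. This is where nonzero exponents matter. -/
theorem ratFuncCongr_prod_cyclotomic_pow {s : Finset ℕ} {m : ℕ → ℕ} {A B : RatFunc ℤ}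
    (hs : ∀ d ∈ s, 0 < d) (hm : ∀ d ∈ s, m d ≠ 0)
    (hAB : ∀ d ∈ s, HasOrdGE (cyclotomic d ℤ) (m d) (A - B)) :
    RatFuncCongr (∏ d ∈ s, cyclotomic d ℤ ^ m d) A B := by
  have hden : (IsFractionRing.den ℤ[X] (A - B) : ℤ[X]) ≠ 0 :=
    nonZeroDivisors.ne_zero (IsFractionRing.den ℤ[X] (A - B)).2
  have hdvd : ∀ d ∈ s, cyclotomic d ℤ ^ m d ∣ IsFractionRing.num ℤ[X] (A - B) := by
    intro d hd
    refine HasOrdGE.pow_dvd_of_div (K := RatFunc ℤ) (prime_cyclotomic (hs d hd))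
      (y := IsFractionRing.den ℤ[X] (A - B)) ?_ ?_
    · exact (map_ne_zero_iff _ (IsFractionRing.injective ℤ[X] (RatFunc ℤ))).2 hden
    · rw [IsFractionRing.mk'_num_den']
      exact hAB d hd
  refine ⟨IsFractionRing.num ℤ[X] (A - B), IsFractionRing.den ℤ[X] (A - B), hden,
    (IsFractionRing.mk'_num_den' ℤ[X] (A - B)).symm, ?_, ?_⟩
  · refine Finset.prod_dvd_of_isRelPrime (fun d hd e he hde => ?_) hdvd
    exact ((isRelPrime_cyclotomic (hs d hd) (hs e he) hde).pow_left).pow_right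
  · refine IsRelPrime.prod_left fun d hd => IsRelPrime.pow_left ?_
    exact (IsFractionRing.num_den_reduced ℤ[X] (A - B)).of_dvd_left
      ((dvd_pow_self _ (hm d hd)).trans (hdvd d hd))

theorem qInteger_mul_cyclotomic_sq {n : ℕ} (hn : 1 < n) :
    qInteger (X : ℤ[X]) n * cyclotomic n ℤ ^ 2 =
      ∏ d ∈ n.divisors.erase 1, cyclotomic d ℤ ^ (if d = n then 3 else 1) := by
  have hmem : n ∈ n.divisors.erase 1 := by simp; omega
  rw [qInteger, ← prod_cyclotomic_eq_geom_sum (by omega) ℤ, ← Finset.mul_prod_erase _ _ hmem,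
    ← Finset.mul_prod_erase _ _ hmem, if_pos rfl, mul_right_comm, ← pow_succ']
  congr 1
  refine Finset.prod_congr rfl fun d hd => ?_
  rw [if_neg (Finset.ne_of_mem_erase hd), pow_one]

end Assembly

end

theorem theorem4 (n : ℕ) (hn : 0 < n) (hn6 : Nat.Coprime n 6) :
    RatFuncCongr (qInteger (X : ℤ[X]) n * cyclotomic n ℤ ^ 2)
      (∑ k ∈ Finset.range n, aTerm (RatFunc.X : RatFunc ℤ) k)
      ((RatFunc.X : RatFunc ℤ) ^ (-((n : ℤ) - 1)) *
        qInteger (RatFunc.X : RatFunc ℤ) n ^ 2) := by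
  rcases Nat.eq_or_lt_of_le (Nat.succ_le_of_lt hn) with rfl | hn1
  -- For `n = 1` both sides equal 1.
  · refine ⟨0, 1, one_ne_zero, ?_, dvd_zero _, isRelPrime_one_right⟩
    simp [aTerm, cTerm, qInteger]
  have odd_form : ∀ d, d ∣ n → ∃ h, d = 2 * h + 1 := fun d hd => by
    have : Nat.Coprime d 2 := coprime_two_of_six (hn6.coprime_dvd_left hd)
    exact (Nat.coprime_two_right.1 this)
  rw [qInteger_mul_cyclotomic_sq hn1, ← RatFunc.algebraMap_X]
  refine ratFuncCongr_prod_cyclotomic_pow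
    (fun d hd => Nat.pos_of_mem_divisors (Finset.mem_of_mem_erase hd))
    (fun d _ => by split_ifs <;> norm_num) fun d hd => ?_
  rw [Finset.mem_erase, Nat.mem_divisors] at hd
  obtain ⟨hd1, hdn, -⟩ := hd
  obtain ⟨H, hH⟩ := odd_form n dvd_rfl
  have e : (algebraMap ℤ[X] (RatFunc ℤ) X) ^ (-((n : ℤ) - 1)) *
      qInteger (algebraMap ℤ[X] (RatFunc ℤ) X) n ^ 2 =
      qInteger (algebraMap ℤ[X] (RatFunc ℤ) X) n ^ 2 /
        (algebraMap ℤ[X] (RatFunc ℤ) X) ^ (2 * H) := by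
    rw [zpow_neg, show (n : ℤ) - 1 = ((2 * H : ℕ) : ℤ) by rw [hH]; push_cast; ring, zpow_natCast,
      div_eq_mul_inv, mul_comm]
  rw [e]
  split_ifs with hdn'
  · subst hdn'
    subst hH
    exact hasOrdGE_three_sum_aTerm_sub hn6 (by omega)
  · obtain ⟨h, rfl⟩ := odd_form d hdn
    have hp : Prime (cyclotomic (2 * h + 1) ℤ) := prime_cyclotomic (by omega)
    have hq : HasOrdGE (cyclotomic (2 * h + 1) ℤ) 1
        (qInteger (algebraMap ℤ[X] (RatFunc ℤ) X) n) :=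
      hasOrdGE_qInteger_of_dvd (by omega) hdn
    have hX := ((hasOrd_X (K := RatFunc ℤ) (d := 2 * h + 1) (by omega)).pow hp (2 * H)).inv
    obtain ⟨m, hm⟩ := hdn
    refine HasOrdGE.sub hp ?_ ?_
    · rw [hm]
      exact hasOrdGE_one_sum_aTerm (hn6.coprime_dvd_left ⟨m, hm⟩) (by omega) m
    · rw [div_eq_mul_inv, pow_two]
      exact ((hq.mul hp hq).mono hp (by norm_num)).mul_right hp (by simpa using hX.hasOrdGE)
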